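/- Let $n,k\ge 1$ be integers and let $0\le\eta\le 1$. For a cost function $H:\{+1,-1\}^n\to\mathbb{R}$ write $E^*=\min_z H(z)$ and, for $E\in\mathbb{R}$, $C(E)=|\{z\in\{+1,-1\}^n : H(z)\le E\}|$. (1) Let $H=\sum_{j=1}^m \mathcal{C}_j$ ($m\ge1$) be a MAX-$k$-CSP instance: each constraint $\mathcal{C}_j$ is a function of at most $k$ of the $n$ bits of $z$; regarded as a function of $k$ bits (adding dummy bits if there are fewer), it takes the value $-1$ on $s_j$ of the $2^k$ settings of these bits and the value $s_j/(2^k-s_j)$ on the other $2^k-s_j$ settings, where $0\le s_j<2^k$. If each of the $n$ variables participates in at most $2km/n$ of the $m$ constraints, then $$C\big((1-\eta)E^*\big)\le 2^{(1-\gamma)n},\qquad \gamma=\left(\frac{|E^*|}{m}\right)^2\frac{(1-\eta)^2}{2\ln(2)\,2^{2k}k^2}.$$ (2) Let $H$ be drawn from the $k$-spin model $$H(z)=\sqrt{\frac{k!}{n^{k-1}}}\sum_{1\le i_1<\dots<i_k\le n}J_{i_1,\dots,i_k}\,z_{i_1}\cdots z_{i_k},$$ where the coefficients $J_{i_1,\dots,i_k}$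 are independent standard Gaussian random variables. Then, with $$\gamma=\frac{(1-\eta)^2}{32\pi\ln(2)\,k^2},$$ with probability at least $1-2^{-\gamma n+1}$ over the choice of $H$, $$C\big((1-\eta)E^*\big)\le 2^{(1-\gamma)n}.$$ -/

import Mathlib

noncomputable section

namespace TailBound

/-- Assignments `z ∈ {+1,-1}^n`. -/
abbrev Assignment (n : ℕ) : Type := Fin n → ℤˣ

/-- The optimal value `E^* = min_z H(z)` of a cost function. -/
def optValue {n : ℕ} (H : Assignment n → ℝ) : ℝ :=
  Finset.univ.inf' Finset.univ_nonempty H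

/-- `C(E)`, the number of assignments `z` with `H(z) ≤ E`. -/
def countBelow {n : ℕ} (H : Assignment n → ℝ) (E : ℝ) : ℕ :=
  (Finset.univ.filter fun z : Assignment n => H z ≤ E).card

/-- A `k`-constraint on `n` bits: a set of at most `k` participating bits, together with the
set of satisfying settings of those bits, which is not the set of all settings. -/
structure Constraint (n k : ℕ) where
  /-- the participating bits -/
  vars : Finset (Fin n)
  card_vars_le : vars.card ≤ k
  /-- the satisfying settings of the participating bits -/
  sat : Finset (vars → ℤˣ)
  sat_ne_univ : sat ≠ Finset.univ

/-- The number `s` of satisfying settings out of `2^k`: if fewer than `k` bits participate, each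
satisfying setting of them is counted once for every setting of the missing `k - |vars|` bits. -/
def Constraint.numSat {n k : ℕ} (c : Constraint n k) : ℕ :=
  2 ^ (k - c.vars.card) * c.sat.card

/-- The value of a constraint: `-1` if satisfied and `s / (2^k - s)` otherwise. -/
def Constraint.value {n k : ℕ} (c : Constraint n k) (z : Assignment n) : ℝ :=
  if (fun i : c.vars => z i) ∈ c.sat then -1 else (c.numSat : ℝ) / ((2 : ℝ) ^ k - c.numSat)

/-- The cost function `H = ∑_j C_j` of a MAX-`k`-CSP instance with `m` constraints. -/
def cspCost {n k m : ℕ} (c : Fin m → Constraint n k) (z : Assignment n) : ℝ :=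
  ∑ j, (c j).value z

/-- The number `d_i` of constraints in which the bit `i` participates. -/
def cspDegree {n k m : ℕ} (c : Fin m → Constraint n k) (i : Fin n) : ℕ :=
  (Finset.univ.filter fun j : Fin m => i ∈ (c j).vars).card

/-- Couplings of the `k`-spin model: one real number for each `k`-element set of spins, that is,
for each `i_1 < ... < i_k`. -/
abbrev Couplings (n k : ℕ) : Type := {S : Finset (Fin n) // S.card = k} → ℝ

/-- `H(z) = sqrt (k! / n^(k-1)) * ∑_{i_1 < ... < i_k} J_{i_1,...,i_k} z_{i_1} ... z_{i_k}`. -/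
def kSpinCost {n k : ℕ} (J : Couplings n k) (z : Assignment n) : ℝ :=
  Real.sqrt ((k.factorial : ℝ) / (n : ℝ) ^ (k - 1)) *
    ∑ S : {S : Finset (Fin n) // S.card = k}, J S * ∏ i ∈ S.1, ((z i : ℤ) : ℝ)

/-- The `k`-spin ensemble: all couplings are independent standard Gaussians. -/
def kSpinLaw (n k : ℕ) : MeasureTheory.Measure (Couplings n k) :=
  MeasureTheory.Measure.pi fun _ => ProbabilityTheory.gaussianReal 0 1

/-- The exponent `γ` for a MAX-`k`-CSP instance with `m` constraints and optimal value `E`. -/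
def cspGamma (k m : ℕ) (E η : ℝ) : ℝ :=
  (|E| / m) ^ 2 * ((1 - η) ^ 2 / (2 * Real.log 2 * 2 ^ (2 * k) * k ^ 2))

/-- The exponent `γ` for the `k`-spin model. -/
def kSpinGamma (k : ℕ) (η : ℝ) : ℝ :=
  (1 - η) ^ 2 / (32 * Real.pi * Real.log 2 * k ^ 2)

end TailBound

end

noncomputable section

namespace TailBound

open MeasureTheory ProbabilityTheory
open scoped NNReal ENNReal

/-! ### Bounded differences on the cube -/

theorem exp_add_exp_le {a b c : ℝ} (h : |a - b| ≤ c) :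
    Real.exp a + Real.exp b ≤ 2 * Real.exp ((a + b) / 2 + c ^ 2 / 8) := by
  have h1 : Real.exp a + Real.exp b = 2 * (Real.exp ((a + b) / 2) * Real.cosh ((a - b) / 2)) := by
    rw [Real.cosh_eq, mul_div_assoc', mul_add, ← Real.exp_add, ← Real.exp_add]
    ring_nf
  rw [h1, Real.exp_add]
  have h2 : ((a - b) / 2) ^ 2 / 2 ≤ c ^ 2 / 8 := by
    have := sq_le_sq' (by linarith [abs_nonneg (a - b), neg_abs_le (a - b)]) ((le_abs_self _).trans h)
    linarith
  have := (Real.cosh_le_exp_half_sq ((a - b) / 2)).trans (Real.exp_le_exp.2 h2)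
  gcongr

theorem sum_assignment_succ {n : ℕ} (f : Assignment (n + 1) → ℝ) :
    ∑ z, f z = ∑ z : Assignment n, (f (Fin.cons 1 z) + f (Fin.cons (-1) z)) := by
  rw [← Fintype.sum_equiv (Fin.consEquiv fun _ => ℤˣ) (fun p => f (Fin.cons p.1 p.2)) f
    (fun _ => rfl), Fintype.sum_prod_type, UnitsInt.univ,
    Finset.sum_pair (by decide), ← Finset.sum_add_distrib]

/-- The bounded differences inequality for the moment generating function on the cube. -/
theorem sum_exp_le_of_bounded_differences {n : ℕ} (f : Assignment n → ℝ) (c : Fin n → ℝ)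
    (hf : ∀ i z a, |f (Function.update z i a) - f z| ≤ c i) :
    ∑ z, Real.exp (f z) ≤ 2 ^ n * Real.exp ((∑ z, f z) / 2 ^ n + (∑ i, c i ^ 2) / 8) := by
  induction n with
  | zero => simp
  | succ n ih =>
    -- Averaging out the first spin preserves the mean and the other difference bounds, and costs a
    -- factor `exp (c 0 ^ 2 / 8)`.
    set g : Assignment n → ℝ := fun z => (f (Fin.cons 1 z) + f (Fin.cons (-1) z)) / 2 with hg
    have hgd : ∀ i z a, |g (Function.update z i a) - g z| ≤ c i.succ := by
      intro i z a
      have h1 := hf i.succ (Fin.cons 1 z) a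
      have h2 := hf i.succ (Fin.cons (-1) z) a
      rw [← Fin.cons_update] at h1 h2
      simp only [hg]
      rw [abs_le] at *
      constructor <;> linarith
    have key : ∀ z : Assignment n, Real.exp (f (Fin.cons 1 z)) + Real.exp (f (Fin.cons (-1) z)) ≤
        2 * Real.exp (c 0 ^ 2 / 8) * Real.exp (g z) := by
      intro z
      have h := hf 0 (Fin.cons (-1) z) 1
      rw [Fin.update_cons_zero] at h
      refine (exp_add_exp_le h).trans (le_of_eq ?_)
      rw [Real.exp_add]
      ring
    rw [sum_assignment_succ, sum_assignment_succ f, Fin.sum_univ_succ]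
    refine (Finset.sum_le_sum fun z _ => key z).trans ?_
    rw [← Finset.mul_sum]
    refine (mul_le_mul_of_nonneg_left (ih g _ hgd) (by positivity)).trans (le_of_eq ?_)
    have : ∑ z, g z = (∑ z : Assignment n, (f (Fin.cons 1 z) + f (Fin.cons (-1) z))) / 2 := by
      rw [Finset.sum_div]
    have h2 : ∀ x y w : ℝ, 2 * Real.exp (x / 8) * (2 ^ n * Real.exp (y / 2 / 2 ^ n + w / 8)) =
        2 ^ (n + 1) * Real.exp (y / 2 ^ (n + 1) + (x + w) / 8) := by
      intro x y w
      rw [mul_mul_mul_comm, ← Real.exp_add, ← pow_succ', div_div, ← pow_succ']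
      ring_nf
    rw [this, h2]

/-- The bounded differences tail bound for a mean zero function on the cube. -/
theorem countBelow_le_of_bounded_differences {n : ℕ} (hn : 1 ≤ n) (H : Assignment n → ℝ) {b : ℝ}
    (hb : 0 < b) (hH : ∀ i z a, |H (Function.update z i a) - H z| ≤ b) (hmean : ∑ z, H z = 0)
    {s : ℝ} (hs : 0 ≤ s) :
    (countBelow H (-s) : ℝ) ≤ 2 ^ n * Real.exp (-(2 * s ^ 2 / (n * b ^ 2))) := by
  have hn' : (0 : ℝ) < n := by exact_mod_cast hn
  -- Minimises the Chernoff exponent $-ts+nt^2b^2/8$.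
  set t : ℝ := 4 * s / (n * b ^ 2) with ht
  have ht0 : 0 ≤ t := by positivity
  have h1 : (countBelow H (-s) : ℝ) ≤ Real.exp (-(t * s)) * ∑ z, Real.exp (-t * H z) := by
    rw [countBelow, Finset.card_eq_sum_ones, Nat.cast_sum, Finset.mul_sum]
    refine (Finset.sum_le_sum (g := fun z => Real.exp (-(t * s)) * Real.exp (-t * H z)) ?_).trans
      (Finset.sum_le_univ_sum_of_nonneg fun z => by positivity)
    intro z hz
    rw [Finset.mem_filter] at hz
    rw [← Real.exp_add, Nat.cast_one]
    apply Real.one_le_exp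
    nlinarith [hz.2]
  have h2 := sum_exp_le_of_bounded_differences (fun z => -t * H z) (fun _ => t * b) (by
    intro i z a
    rw [← mul_sub, abs_mul, abs_neg, abs_of_nonneg ht0]
    exact mul_le_mul_of_nonneg_left (hH i z a) ht0)
  rw [← Finset.mul_sum, hmean] at h2
  refine (h1.trans (mul_le_mul_of_nonneg_left h2 (Real.exp_pos _).le)).trans (le_of_eq ?_)
  rw [mul_left_comm, ← Real.exp_add]
  congr 2
  simp only [Finset.sum_const, Finset.card_univ, Fintype.card_fin, nsmul_eq_mul, ht]
  field_simp
  ring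

/-! ### MAX-$k$-CSP instances -/

theorem optValue_nonpos_of_sum_eq_zero {n : ℕ} {H : Assignment n → ℝ} (h : ∑ z, H z = 0) :
    optValue H ≤ 0 := by
  obtain ⟨z, -, hz⟩ := Finset.exists_le_of_sum_le (f := H) (g := fun _ => 0) (s := Finset.univ)
    Finset.univ_nonempty (by simp [h])
  exact (Finset.inf'_le _ (Finset.mem_univ z)).trans hz

theorem Constraint.card_sat_lt {n k : ℕ} (c : Constraint n k) : c.sat.card < 2 ^ c.vars.card := by
  have := Finset.card_lt_univ_of_notMem
    (Classical.not_forall.1 (mt Finset.eq_univ_iff_forall.2 c.sat_ne_univ)).choose_spec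
  simpa using this

theorem Constraint.numSat_lt {n k : ℕ} (c : Constraint n k) : c.numSat < 2 ^ k := by
  have h := c.card_sat_lt
  calc c.numSat < 2 ^ (k - c.vars.card) * 2 ^ c.vars.card := by
        rw [Constraint.numSat]
        gcongr
    _ = 2 ^ k := by rw [← pow_add, Nat.sub_add_cancel c.card_vars_le]

theorem Constraint.one_le_sub_numSat {n k : ℕ} (c : Constraint n k) :
    (1 : ℝ) ≤ 2 ^ k - c.numSat := by
  have : ((c.numSat + 1 : ℕ) : ℝ) ≤ ((2 ^ k : ℕ) : ℝ) := by exact_mod_cast c.numSat_lt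
  push_cast at this
  linarith

/-- The value of a constraint lies in an interval of length at most `2 ^ k`. -/
theorem Constraint.abs_value_sub_value_le {n k : ℕ} (c : Constraint n k) (z w : Assignment n) :
    |c.value z - c.value w| ≤ 2 ^ k := by
  have h := c.one_le_sub_numSat
  have h0 : (0 : ℝ) ≤ c.numSat := Nat.cast_nonneg _
  -- The sum is $2^k/(2^k-s)$, and the integer $2^k-s$ is at least 1.
  have h1 : (c.numSat : ℝ) / (2 ^ k - c.numSat) + 1 ≤ 2 ^ k := by
    rw [div_add_one (by linarith), div_le_iff₀ (by linarith)]
    nlinarith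
  have h2 : 0 ≤ (c.numSat : ℝ) / (2 ^ k - c.numSat) := div_nonneg h0 (by linarith)
  unfold Constraint.value
  split_ifs <;> rw [abs_le] <;> constructor <;> linarith

theorem Constraint.value_update_of_notMem {n k : ℕ} (c : Constraint n k) (z : Assignment n)
    {i : Fin n} (hi : i ∉ c.vars) (a : ℤˣ) : c.value (Function.update z i a) = c.value z := by
  have : (fun j : c.vars => Function.update z i a j) = fun j : c.vars => z j := by
    funext j
    exact Function.update_of_ne (fun h : (j : Fin n) = i => hi (h ▸ j.2)) _ _
  unfold Constraint.value
  rw [this]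

theorem card_filter_restrict_mem {n : ℕ} (s : Finset (Fin n)) (A : Finset (s → ℤˣ)) :
    (Finset.univ.filter fun z : Assignment n => (fun i : s => z i) ∈ A).card =
      2 ^ (n - s.card) * A.card := by
  classical
  let e := Equiv.piEquivPiSubtypeProd (fun i => i ∈ s) (fun _ : Fin n => ℤˣ)
  have h : (Finset.univ.filter fun z : Assignment n => (fun i : s => z i) ∈ A).card =
      (A ×ˢ (Finset.univ : Finset ({i // i ∉ s} → ℤˣ))).card := by
    refine Finset.card_bij' (fun z _ => e z) (fun p _ => e.symm p) ?_ ?_ ?_ ?_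
    · intro z hz
      simpa [e] using hz
    · rintro p hp
      have := (Finset.mem_product.1 hp).1
      rw [Finset.mem_filter]
      refine ⟨Finset.mem_univ _, ?_⟩
      have h2 : (fun i : s => (e.symm p) i) = p.1 := congrArg Prod.fst (e.apply_symm_apply p)
      rwa [h2]
    · intro z _
      exact e.symm_apply_apply z
    · intro p _
      exact e.apply_symm_apply p
  rw [h, Finset.card_product, mul_comm, Finset.card_univ, Fintype.card_fun]
  simp [Fintype.card_subtype_compl]

/-- Constraints are normalised to have mean zero. -/
theorem Constraint.sum_value {n k : ℕ} (c : Constraint n k) : ∑ z, c.value z = 0 := by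
  have hcard := card_filter_restrict_mem c.vars c.sat
  have htot := Finset.card_filter_add_card_filter_not (s := (Finset.univ : Finset (Assignment n)))
    (fun z => (fun i : c.vars => z i) ∈ c.sat)
  have hun : (Finset.univ : Finset (Assignment n)).card = 2 ^ n := by simp
  rw [hun, hcard] at htot
  simp only [Constraint.value]
  rw [Finset.sum_ite, Finset.sum_const, Finset.sum_const, hcard, nsmul_eq_mul, nsmul_eq_mul]
  have hvn : c.vars.card ≤ n := by simpa using c.vars.card_le_univ
  have hvk := c.card_vars_le
  have htot' := congrArg (Nat.cast : ℕ → ℝ) htot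
  push_cast at htot' ⊢
  have h := c.one_le_sub_numSat
  have hne : (2 : ℝ) ^ k - c.numSat ≠ 0 := by linarith
  rw [eq_sub_of_add_eq' htot']
  field_simp
  rw [Constraint.numSat]
  push_cast
  -- The factors for dummy bits in `numSat` and for free bits in the count separate from
  -- $2^{|\mathrm{vars}|}$, so both give the same satisfied fraction.
  rw [show (2 : ℝ) ^ k = 2 ^ (k - c.vars.card) * 2 ^ c.vars.card by
    rw [← pow_add, Nat.sub_add_cancel hvk],
    show (2 : ℝ) ^ n = 2 ^ (n - c.vars.card) * 2 ^ c.vars.card by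
    rw [← pow_add, Nat.sub_add_cancel hvn]]
  ring

theorem sum_cspCost {n k m : ℕ} (c : Fin m → Constraint n k) : ∑ z, cspCost c z = 0 := by
  simp only [cspCost]
  rw [Finset.sum_comm]
  exact Finset.sum_eq_zero fun j _ => (c j).sum_value

theorem abs_cspCost_update_sub_le {n k m : ℕ} (c : Fin m → Constraint n k) (i : Fin n)
    (z : Assignment n) (a : ℤˣ) :
    |cspCost c (Function.update z i a) - cspCost c z| ≤ cspDegree c i * 2 ^ k := by
  simp only [cspCost, cspDegree]
  rw [← Finset.sum_sub_distrib, ← nsmul_eq_mul, ← Finset.sum_const, Finset.sum_filter]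
  refine (Finset.abs_sum_le_sum_abs _ _).trans (Finset.sum_le_sum fun j _ => ?_)
  split_ifs with h
  · exact (c j).abs_value_sub_value_le _ _
  · rw [(c j).value_update_of_notMem z h, sub_self, abs_zero]

theorem two_rpow_one_sub_mul (g : ℝ) (n : ℕ) :
    (2 : ℝ) ^ ((1 - g) * (n : ℝ)) = 2 ^ n * Real.exp (-(g * n * Real.log 2)) := by
  rw [sub_mul, one_mul, Real.rpow_sub two_pos, Real.rpow_natCast, Real.exp_neg, div_eq_mul_inv,
    Real.rpow_def_of_pos two_pos, mul_comm (Real.log 2)]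

theorem countBelow_cspCost_le {n k m : ℕ} (hn : 1 ≤ n) (hk : 1 ≤ k) (hm : 1 ≤ m) {η : ℝ}
    (hη : η ≤ 1) (c : Fin m → Constraint n k)
    (hc : ∀ i, (cspDegree c i : ℝ) ≤ 2 * (k : ℝ) * (m : ℝ) / (n : ℝ)) :
    (countBelow (cspCost c) ((1 - η) * optValue (cspCost c)) : ℝ) ≤
      (2 : ℝ) ^ ((1 - cspGamma k m (optValue (cspCost c)) η) * (n : ℝ)) := by
  have hn' : (0 : ℝ) < n := by exact_mod_cast hn
  have hk' : (0 : ℝ) < k := by exact_mod_cast hk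
  have hm' : (0 : ℝ) < m := by exact_mod_cast hm
  set E := optValue (cspCost c)
  have hE : E ≤ 0 := optValue_nonpos_of_sum_eq_zero (sum_cspCost c)
  -- Here `b` is the degree bound times the spread of one constraint; $E^*\le0$ makes the depth
  -- nonnegative.
  have h := countBelow_le_of_bounded_differences hn (cspCost c)
    (b := 2 * (k : ℝ) * (m : ℝ) / (n : ℝ) * 2 ^ k) (by positivity)
    (fun i z a => (abs_cspCost_update_sub_le c i z a).trans (by gcongr; exact hc i))
    (sum_cspCost c) (s := (1 - η) * -E) (mul_nonneg (by linarith) (by linarith))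
  rw [mul_neg, neg_neg] at h
  refine h.trans (le_of_eq ?_)
  rw [two_rpow_one_sub_mul]
  congr 3
  have hlog : Real.log 2 ≠ 0 := (Real.log_pos one_lt_two).ne'
  rw [cspGamma, div_pow |E|, sq_abs, pow_mul' (2 : ℝ) 2 k]
  field_simp

/-! ### Gaussian estimates -/

/-- Since $e^x\ge 1+x+x^2/2$, it suffices that $(1-x+x^2/2)(1+x+x^2/2)=1+x^4/4\ge1$. -/
theorem exp_neg_le_quadratic {x : ℝ} (hx : 0 ≤ x) : Real.exp (-x) ≤ 1 - x + x ^ 2 / 2 := by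
  rw [Real.exp_neg]
  have h := Real.quadratic_le_exp_of_nonneg hx
  rw [inv_le_iff_one_le_mul₀ (Real.exp_pos x)]
  have h1 : 0 ≤ 1 - x + x ^ 2 / 2 := by nlinarith [sq_nonneg (x - 1)]
  refine le_trans ?_ (mul_le_mul_of_nonneg_left h h1)
  nlinarith [sq_nonneg (x ^ 2)]

theorem integral_Ioi_mul_exp_neg_mul_sq {b : ℝ} (hb : 0 < b) :
    ∫ x in Set.Ioi (0 : ℝ), x * Real.exp (-b * x ^ 2) = (2 * b)⁻¹ := by
  have h := integral_mul_cexp_neg_mul_sq (b := (b : ℂ)) (by simpa using hb)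
  have h2 : ∀ r : ℝ, (r : ℂ) * Complex.exp (-(b : ℂ) * (r : ℂ) ^ 2) =
      ((r * Real.exp (-b * r ^ 2) : ℝ) : ℂ) := by
    intro r
    push_cast
    rfl
  simp_rw [h2] at h
  rw [integral_complex_ofReal] at h
  exact_mod_cast h

theorem integral_abs_gaussianReal (v : ℝ≥0) :
    ∫ x, |x| ∂(gaussianReal 0 v) = Real.sqrt 2 / Real.sqrt Real.pi * Real.sqrt v := by
  by_cases hv : v = 0
  · simp [hv]
  have hv' : (0 : ℝ) < v := by positivity
  rw [integral_gaussianReal_eq_integral_smul hv]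
  have h1 : ∀ x : ℝ, gaussianPDFReal 0 v x • |x| =
      (fun y => (Real.sqrt (2 * Real.pi * v))⁻¹ * (y * Real.exp (-(2 * (v : ℝ))⁻¹ * y ^ 2))) |x| := by
    intro x
    simp only [gaussianPDFReal, sub_zero, sq_abs, smul_eq_mul]
    rw [show -x ^ 2 / (2 * (v : ℝ)) = -(2 * (v : ℝ))⁻¹ * x ^ 2 by field_simp]
    ring
  simp_rw [h1]
  rw [integral_comp_abs (f := fun y => (Real.sqrt (2 * Real.pi * v))⁻¹ *
      (y * Real.exp (-(2 * (v : ℝ))⁻¹ * y ^ 2))), integral_const_mul,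
    integral_Ioi_mul_exp_neg_mul_sq (by positivity), Real.sqrt_mul (by positivity),
    Real.sqrt_mul (by positivity)]
  have hp := Real.sqrt_pos.2 Real.pi_pos
  have hs := Real.sqrt_pos.2 hv'
  have h2 := Real.sqrt_pos.2 (two_pos (α := ℝ))
  field_simp
  rw [Real.sq_sqrt hv'.le, Real.sq_sqrt two_pos.le]

/-- The quadratic bound on $e^{-l|x|}$ needs only the first two absolute moments; then $1+u\le e^u$
restores an exponential, so that bounds for successive spins multiply. -/
theorem lintegral_exp_neg_mul_abs_gaussianReal_le (v : ℝ≥0) {l : ℝ} (hl : 0 ≤ l) :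
    ∫⁻ x, ENNReal.ofReal (Real.exp (-(l * |x|))) ∂(gaussianReal 0 v) ≤
      ENNReal.ofReal (Real.exp
        (-(Real.sqrt 2 / Real.sqrt Real.pi * (l * Real.sqrt v)) + l ^ 2 * v / 2)) := by
  have hi1 : Integrable (fun x : ℝ => |x|) (gaussianReal 0 v) :=
    ((memLp_id_gaussianReal' (μ := 0) (v := v) 1 (by simp)).integrable le_rfl).abs
  have hi2 : Integrable (fun x : ℝ => x ^ 2) (gaussianReal 0 v) :=
    (memLp_id_gaussianReal' (μ := 0) (v := v) 2 (by simp)).integrable_sq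
  have hsq : ∫ x, x ^ 2 ∂(gaussianReal 0 v) = v := by
    have h := variance_fun_id_gaussianReal (μ := 0) (v := v)
    rw [variance_of_integral_eq_zero (by fun_prop) (by simp)] at h
    exact h
  have hi3 : Integrable (fun x : ℝ => 1 - l * |x|) (gaussianReal 0 v) :=
    (integrable_const _).sub (hi1.const_mul _)
  have hint : Integrable (fun x : ℝ => 1 - l * |x| + l ^ 2 / 2 * x ^ 2) (gaussianReal 0 v) :=
    hi3.add (hi2.const_mul _)
  have hle : ∀ x : ℝ, Real.exp (-(l * |x|)) ≤ 1 - l * |x| + l ^ 2 / 2 * x ^ 2 := by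
    intro x
    refine (exp_neg_le_quadratic (by positivity)).trans (le_of_eq ?_)
    rw [mul_pow, sq_abs]
    ring
  calc ∫⁻ x, ENNReal.ofReal (Real.exp (-(l * |x|))) ∂(gaussianReal 0 v)
      ≤ ∫⁻ x, ENNReal.ofReal (1 - l * |x| + l ^ 2 / 2 * x ^ 2) ∂(gaussianReal 0 v) :=
        lintegral_mono fun x => ENNReal.ofReal_le_ofReal (hle x)
    _ = ENNReal.ofReal (∫ x, (1 - l * |x| + l ^ 2 / 2 * x ^ 2) ∂(gaussianReal 0 v)) :=
        (ofReal_integral_eq_lintegral_ofReal hint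
          (ae_of_all _ fun x => (Real.exp_pos _).le.trans (hle x))).symm
    _ ≤ _ := by
        refine ENNReal.ofReal_le_ofReal ?_
        rw [integral_add hi3 (hi2.const_mul _),
          integral_sub (integrable_const _) (hi1.const_mul _), integral_const_mul,
          integral_const_mul, hsq, integral_abs_gaussianReal]
        simp only [integral_const, probReal_univ, smul_eq_mul, mul_one]
        refine le_trans (le_of_eq ?_) (Real.add_one_le_exp _)
        ring

/-- A linear form in independent standard Gaussians is Gaussian. -/
theorem map_sum_mul_pi_gaussianReal {ι : Type*} [Fintype ι] (a : ι → ℝ) (v : ℝ≥0)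
    (hv : (v : ℝ) = ∑ i, a i ^ 2) :
    (Measure.pi fun _ : ι => gaussianReal 0 1).map (fun x => ∑ i, x i * a i) =
      gaussianReal 0 v := by
  have hm : Measurable fun x : ι → ℝ => ∑ i, x i * a i := by fun_prop
  have : IsProbabilityMeasure
      ((Measure.pi fun _ : ι => gaussianReal 0 1).map (fun x => ∑ i, x i * a i)) :=
    Measure.isProbabilityMeasure_map hm.aemeasurable
  refine Measure.ext_of_charFun ?_
  ext t
  rw [charFun_apply_real, integral_map hm.aemeasurable (by fun_prop), charFun_gaussianReal]
  have h1 : ∀ x : ι → ℝ, Complex.exp (t * ((∑ i, x i * a i : ℝ) : ℂ) * Complex.I) =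
      ∏ i, Complex.exp (((t * a i : ℝ) : ℂ) * (x i : ℂ) * Complex.I) := by
    intro x
    rw [← Complex.exp_sum]
    congr 1
    push_cast
    rw [Finset.mul_sum, Finset.sum_mul]
    exact Finset.sum_congr rfl fun i _ => by ring
  simp_rw [h1]
  rw [integral_fintype_prod_eq_prod
    (f := fun i (y : ℝ) => Complex.exp (((t * a i : ℝ) : ℂ) * (y : ℂ) * Complex.I))]
  simp_rw [← charFun_apply_real, charFun_gaussianReal]
  rw [← Complex.exp_sum]
  congr 1
  have hv' : ((v : ℝ) : ℂ) = ∑ i, (a i : ℂ) ^ 2 := by rw [hv]; push_cast; rfl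
  rw [hv', Finset.sum_mul, Finset.sum_div]
  simp only [Complex.ofReal_zero, mul_zero, zero_mul, zero_sub, NNReal.coe_one, Complex.ofReal_one]
  rw [Finset.sum_neg_distrib]
  congr 1
  refine Finset.sum_congr rfl fun i _ => ?_
  push_cast
  ring

theorem gaussianReal_real_Iic_neg_le {v : ℝ≥0} (hv : v ≠ 0) {s : ℝ} (hs : 0 ≤ s) :
    (gaussianReal 0 v).real (Set.Iic (-s)) ≤ Real.exp (-(s ^ 2 / (2 * v))) := by
  have hv' : (0 : ℝ) < v := by positivity
  -- The parameter $-s/v$ minimises $ts+vt^2/2$.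
  have h := measure_le_le_exp_mul_mgf (μ := gaussianReal 0 v) (X := id) (t := -(s / v)) (-s)
    (by simp only [Left.neg_nonpos_iff]; positivity)
    (integrable_exp_mul_gaussianReal _)
  rw [mgf_gaussianReal (μ := 0) (v := v) (by simp), ← Real.exp_add] at h
  refine h.trans (le_of_eq ?_)
  congr 1
  field_simp
  ring

/-! ### Resampling and the first moment method -/

/-- Combine two configurations: `y` where `p` holds, and `x` elsewhere. -/
def splice {ι : Type*} (p : ι → Prop) [DecidablePred p] (x y : ι → ℝ) : ι → ℝ :=
  fun i => if p i then y i else x i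

/-- This plays the role of conditioning: the coordinates in `p` can be integrated as a fresh sample
with the others held fixed. -/
theorem measurePreserving_splice {ι : Type*} [Fintype ι] (p : ι → Prop) [DecidablePred p]
    (ν : Measure ℝ) [IsProbabilityMeasure ν] :
    MeasurePreserving (fun q : (ι → ℝ) × (ι → ℝ) => splice p q.1 q.2)
      ((Measure.pi fun _ => ν).prod (Measure.pi fun _ => ν)) (Measure.pi fun _ => ν) := by
  have hm : Measurable fun q : (ι → ℝ) × (ι → ℝ) => splice p q.1 q.2 := by
    refine measurable_pi_lambda _ fun i => ?_
    unfold splice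
    split_ifs <;> fun_prop
  refine ⟨hm, (Measure.pi_eq fun s hs => ?_).symm⟩
  rw [Measure.map_apply hm (MeasurableSet.univ_pi hs)]
  have hpre : (fun q : (ι → ℝ) × (ι → ℝ) => splice p q.1 q.2) ⁻¹' (Set.univ.pi s) =
      (Set.univ.pi fun i => if p i then Set.univ else s i) ×ˢ
        (Set.univ.pi fun i => if p i then s i else Set.univ) := by
    ext q
    simp only [Set.mem_preimage, Set.mem_pi, Set.mem_univ, forall_true_left, Set.mem_prod, splice]
    rw [← forall_and]
    refine forall_congr' fun i => ?_
    split_ifs <;> simp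
  rw [hpre, Measure.prod_prod, Measure.pi_pi, Measure.pi_pi, ← Finset.prod_mul_distrib]
  refine Finset.prod_congr rfl fun i _ => ?_
  split_ifs <;> simp

/-- Markov's inequality for the number of events, out of a finite family, that occur. -/
theorem measure_le_card_filter_le {Ω ι : Type*} [MeasurableSpace Ω] (μ : Measure Ω)
    [IsProbabilityMeasure μ] [Fintype ι] (A : ι → Ω → Prop) [∀ x, DecidablePred fun i => A i x]
    (hA : ∀ i, MeasurableSet {x | A i x}) {p a : ℝ} (hp : ∀ i, μ.real {x | A i x} ≤ p)
    (ha : 0 < a) :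
    μ.real {x | a ≤ ((Finset.univ.filter fun i => A i x).card : ℝ)} ≤ Fintype.card ι * p / a := by
  have heq : ∀ x, ((Finset.univ.filter fun i => A i x).card : ℝ) =
      ∑ i, ({x | A i x}.indicator (fun _ => (1 : ℝ)) x) := by
    intro x
    rw [Finset.card_eq_sum_ones, Nat.cast_sum, Finset.sum_filter]
    refine Finset.sum_congr rfl fun i _ => ?_
    simp [Set.indicator_apply]
  have hint : ∀ i, Integrable ({x | A i x}.indicator (fun _ => (1 : ℝ))) μ := fun i =>
    (integrable_const _).indicator (hA i)
  have h := mul_meas_ge_le_integral_of_nonneg (μ := μ)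
    (f := fun x => ((Finset.univ.filter fun i => A i x).card : ℝ))
    (ae_of_all _ fun x => Nat.cast_nonneg _)
    (by simp_rw [heq]; exact integrable_finsetSum _ fun i _ => hint i) a
  rw [le_div_iff₀' ha]
  refine h.trans ?_
  simp_rw [heq]
  rw [integral_finsetSum _ fun i _ => hint i]
  refine (Finset.sum_le_sum fun i _ => ?_).trans (le_of_eq (Finset.sum_const p |>.trans ?_))
  · rw [integral_indicator_const _ (hA i)]
    simpa using hp i
  · simp

/-! ### Coupling sets ordered by their largest spin -/

/-- The product of the spins of `z` in `S`, as a real number. -/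
def spinProd {n : ℕ} (S : Finset (Fin n)) (z : Assignment n) : ℝ :=
  ∏ i ∈ S, ((z i : ℤ) : ℝ)

theorem spinProd_sq {n : ℕ} (S : Finset (Fin n)) (z : Assignment n) : spinProd S z ^ 2 = 1 := by
  rw [spinProd, ← Finset.prod_pow]
  refine Finset.prod_eq_one fun i _ => ?_
  rcases Int.units_eq_one_or (z i) with h | h <;> simp [h]

theorem spinProd_update_of_notMem {n : ℕ} {S : Finset (Fin n)} {i : Fin n} (hi : i ∉ S)
    (z : Assignment n) (a : ℤˣ) : spinProd S (Function.update z i a) = spinProd S z := by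
  refine Finset.prod_congr rfl fun j hj => ?_
  rw [Function.update_of_ne fun h : j = i => hi (h ▸ hj)]

theorem spinProd_update_neg_of_mem {n : ℕ} {S : Finset (Fin n)} {i : Fin n} (hi : i ∈ S)
    (z : Assignment n) : spinProd S (Function.update z i (-z i)) = -spinProd S z := by
  unfold spinProd
  rw [← Finset.mul_prod_erase _ _ hi, ← Finset.mul_prod_erase _ (fun i => ((z i : ℤ) : ℝ)) hi,
    Function.update_self, ← neg_mul]
  congr 1
  · simp
  · exact spinProd_update_of_notMem (Finset.notMem_erase i S) z _

/-- The `k`-element sets of spins all of whose elements are smaller than `t`. -/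
def setsBelow (n k t : ℕ) : Finset {S : Finset (Fin n) // S.card = k} :=
  Finset.univ.filter fun S => ∀ i ∈ S.1, (i : ℕ) < t

/-- The `k`-element sets of spins with largest element `i`. -/
def setsWithMax {n : ℕ} (k : ℕ) (i : Fin n) : Finset {S : Finset (Fin n) // S.card = k} :=
  Finset.univ.filter fun S => i ∈ S.1 ∧ ∀ j ∈ S.1, j ≤ i

theorem card_setsBelow {n k t : ℕ} (ht : t ≤ n) : (setsBelow n k t).card = t.choose k := by
  have h1 : (Finset.univ.filter fun i : Fin n => (i : ℕ) < t).card = t := by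
    rw [Fin.card_filter_val_lt, min_eq_right ht]
  rw [← Finset.card_map (Function.Embedding.subtype _), ← h1, ← Finset.card_powersetCard, h1]
  congr 1
  ext S
  simp only [setsBelow, Finset.mem_map, Finset.mem_filter, Finset.mem_univ, true_and,
    Function.Embedding.subtype_apply, Subtype.exists, exists_and_right, exists_eq_right,
    Finset.mem_powersetCard, Finset.subset_iff]
  constructor
  · rintro ⟨h, h2⟩
    exact ⟨h2, h⟩
  · rintro ⟨h2, h⟩
    exact ⟨h, h2⟩

theorem disjoint_setsBelow_setsWithMax {n k : ℕ} (i : Fin n) :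
    Disjoint (setsBelow n k i) (setsWithMax k i) := by
  rw [Finset.disjoint_left]
  intro S h1 h2
  simp only [setsBelow, setsWithMax, Finset.mem_filter] at h1 h2
  exact lt_irrefl _ (h1.2 i h2.2.1)

theorem setsBelow_succ {n k : ℕ} (i : Fin n) :
    setsBelow n k (i + 1) = (setsBelow n k i).disjUnion (setsWithMax k i)
      (disjoint_setsBelow_setsWithMax i) := by
  ext S
  simp only [setsBelow, setsWithMax, Finset.mem_disjUnion, Finset.mem_filter, Finset.mem_univ,
    true_and]
  constructor
  · intro h
    by_cases hi : i ∈ S.1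
    · exact Or.inr ⟨hi, fun j hj => Fin.le_def.2 (Nat.lt_succ_iff.1 (h j hj))⟩
    · refine Or.inl fun j hj => lt_of_le_of_ne (Nat.lt_succ_iff.1 (h j hj)) fun he => hi ?_
      rwa [← Fin.ext he]
  · rintro (h | h) j hj
    · exact (h j hj).trans (Nat.lt_succ_self _)
    · exact Nat.lt_succ_iff.2 (h.2 j hj)

/-- Pascal's rule applied to `setsBelow_succ`. This cardinality is the variance of the unnormalised
energy brought in by spin `i`. -/
theorem card_setsWithMax {n k : ℕ} (i : Fin n) :
    (setsWithMax (k + 1) i).card = (i : ℕ).choose k := by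
  have h := card_setsBelow (n := n) (k := k + 1) (t := i + 1) i.2
  rw [setsBelow_succ, Finset.card_disjUnion, card_setsBelow i.2.le, Nat.choose_succ_succ'] at h
  omega

/-- The energy of the couplings supported on `A`. -/
def partialCost {n k : ℕ} (A : Finset {S : Finset (Fin n) // S.card = k}) (J : Couplings n k)
    (z : Assignment n) : ℝ :=
  ∑ S ∈ A, J S * spinProd S.1 z

theorem partialCost_congr {n k : ℕ} {A : Finset {S : Finset (Fin n) // S.card = k}}
    {J K : Couplings n k} (h : ∀ S ∈ A, J S = K S) (z : Assignment n) :
    partialCost A J z = partialCost A K z :=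
  Finset.sum_congr rfl fun S hS => by rw [h S hS]

theorem measurable_partialCost {n k : ℕ} (A : Finset {S : Finset (Fin n) // S.card = k})
    (z : Assignment n) : Measurable fun J => partialCost A J z := by
  unfold partialCost
  fun_prop

theorem map_partialCost_kSpinLaw {n k : ℕ} (A : Finset {S : Finset (Fin n) // S.card = k})
    (z : Assignment n) :
    (kSpinLaw n k).map (fun J => partialCost A J z) = gaussianReal 0 (A.card : ℝ≥0) := by
  classical
  have h := map_sum_mul_pi_gaussianReal
    (fun S : {S : Finset (Fin n) // S.card = k} => if S ∈ A then spinProd S.1 z else 0)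
    (A.card : ℝ≥0) (by simp [ite_pow, spinProd_sq])
  rw [← h, kSpinLaw]
  congr 1
  funext J
  simp [partialCost, mul_ite]

/-! ### Exponential moments of the optimum -/

theorem optValue_le {n : ℕ} (H : Assignment n → ℝ) (z : Assignment n) : optValue H ≤ H z :=
  Finset.inf'_le _ (Finset.mem_univ z)

theorem exists_eq_optValue {n : ℕ} (H : Assignment n → ℝ) : ∃ z, H z = optValue H := by
  obtain ⟨z, -, hz⟩ := Finset.exists_mem_eq_inf' (Finset.univ_nonempty) H
  exact ⟨z, hz.symm⟩

theorem measurable_optValue {n : ℕ} {Ω : Type*} [MeasurableSpace Ω] {H : Ω → Assignment n → ℝ}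
    (hH : ∀ z, Measurable fun x => H x z) : Measurable fun x => optValue (H x) := by
  simp only [optValue, Finset.inf'_univ_eq_ciInf]
  exact Measurable.iInf hH

/-- Choosing the sign of the spin `i` optimally lowers the energy by the absolute value of the
energy of the couplings with largest element `i`. -/
theorem optValue_partialCost_succ_le {n k : ℕ} (i : Fin n) (J : Couplings n k)
    (y : Assignment n) :
    optValue (partialCost (setsBelow n k (i + 1)) J) ≤
      partialCost (setsBelow n k i) J y - |partialCost (setsWithMax k i) J y| := by
  have hsplit : ∀ z, partialCost (setsBelow n k (i + 1)) J z =
      partialCost (setsBelow n k i) J z + partialCost (setsWithMax k i) J z := by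
    intro z
    rw [partialCost, setsBelow_succ, Finset.sum_disjUnion]
    rfl
  rcases le_total (partialCost (setsWithMax k i) J y) 0 with h | h
  · rw [abs_of_nonpos h, sub_neg_eq_add, ← hsplit]
    exact optValue_le _ _
  -- Every set with largest element `i` contains `i`, so flipping that spin negates the new energy;
  -- the sets below `i` do not see it.
  · refine (optValue_le _ (Function.update y i (-y i))).trans (le_of_eq ?_)
    rw [abs_of_nonneg h, hsplit, sub_eq_add_neg]
    congr 1
    · refine Finset.sum_congr rfl fun S hS => ?_
      rw [spinProd_update_of_notMem]
      intro hi
      exact lt_irrefl _ ((Finset.mem_filter.1 hS).2 i hi)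
    · unfold partialCost
      rw [← Finset.sum_neg_distrib]
      refine Finset.sum_congr rfl fun S hS => ?_
      rw [spinProd_update_neg_of_mem (Finset.mem_filter.1 hS).2.1, mul_neg]

instance isProbabilityMeasure_kSpinLaw (n k : ℕ) : IsProbabilityMeasure (kSpinLaw n k) := by
  unfold kSpinLaw
  infer_instance

/-- One greedy step. All couplings containing `i` are resampled: none of them enters the old energy,
and the new energy uses only these. -/
theorem lintegral_exp_optValue_succ_le {n k : ℕ} (i : Fin n) {l : ℝ} (hl : 0 ≤ l) :
    ∫⁻ J, ENNReal.ofReal (Real.exp (l * optValue (partialCost (setsBelow n (k + 1) (i + 1)) J)))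
        ∂(kSpinLaw n (k + 1)) ≤
      (∫⁻ J, ENNReal.ofReal (Real.exp (l * optValue (partialCost (setsBelow n (k + 1) i) J)))
        ∂(kSpinLaw n (k + 1))) *
      ENNReal.ofReal (Real.exp (-(Real.sqrt 2 / Real.sqrt Real.pi *
        (l * Real.sqrt ((i : ℕ).choose k))) + l ^ 2 * ((i : ℕ).choose k) / 2)) := by
  have hmeas : ∀ A : Finset {S : Finset (Fin n) // S.card = k + 1}, Measurable fun J =>
      ENNReal.ofReal (Real.exp (l * optValue (partialCost A J))) := fun A =>
    (((measurable_optValue (measurable_partialCost A)).const_mul l).exp).ennreal_ofReal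
  have hsp := measurePreserving_splice
    (fun S : {S : Finset (Fin n) // S.card = k + 1} => i ∈ S.1) (gaussianReal 0 1)
  change MeasurePreserving _ ((kSpinLaw n (k + 1)).prod (kSpinLaw n (k + 1)))
    (kSpinLaw n (k + 1)) at hsp
  rw [← hsp.lintegral_comp (hmeas _), lintegral_prod
    (fun q : Couplings n (k + 1) × Couplings n (k + 1) => ENNReal.ofReal (Real.exp (l * optValue
      (partialCost (setsBelow n (k + 1) (i + 1)) (splice (fun S => i ∈ S.1) q.1 q.2)))))
    ((hmeas (setsBelow n (k + 1) (i + 1))).comp hsp.measurable).aemeasurable,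
    ← lintegral_mul_const _ (hmeas _)]
  refine lintegral_mono fun x => ?_
  -- The minimiser `y` depends on the old couplings `x` alone, so the new energy at `y` is Gaussian
  -- under the fresh sample `w`.
  obtain ⟨y, hy⟩ := exists_eq_optValue (partialCost (setsBelow n (k + 1) i) x)
  have hpt : ∀ w : Couplings n (k + 1),
      l * optValue (partialCost (setsBelow n (k + 1) (i + 1)) (splice (fun S => i ∈ S.1) x w)) ≤
      l * optValue (partialCost (setsBelow n (k + 1) i) x) +
        -(l * |partialCost (setsWithMax (k + 1) i) w y|) := by
    intro w
    have h := optValue_partialCost_succ_le i (splice (fun S => i ∈ S.1) x w) y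
    rw [partialCost_congr (A := setsBelow n (k + 1) i) (K := x) (by
        intro S hS
        exact if_neg fun hi => lt_irrefl _ ((Finset.mem_filter.1 hS).2 i hi)),
      partialCost_congr (A := setsWithMax (k + 1) i) (K := w) (by
        intro S hS
        exact if_pos (Finset.mem_filter.1 hS).2.1), hy] at h
    rw [← mul_neg, ← mul_add]
    exact mul_le_mul_of_nonneg_left (by linarith) hl
  calc _ ≤ ∫⁻ w, ENNReal.ofReal (Real.exp (l * optValue (partialCost (setsBelow n (k + 1) i) x))) *
        ENNReal.ofReal (Real.exp (-(l * |partialCost (setsWithMax (k + 1) i) w y|)))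
          ∂(kSpinLaw n (k + 1)) := by
        refine lintegral_mono fun w => ?_
        rw [← ENNReal.ofReal_mul (Real.exp_pos _).le, ← Real.exp_add]
        exact ENNReal.ofReal_le_ofReal (Real.exp_le_exp.2 (hpt w))
    _ ≤ _ := by
        have hg : Measurable fun r : ℝ => ENNReal.ofReal (Real.exp (-(l * |r|))) := by fun_prop
        have hm := measurable_partialCost (setsWithMax (k + 1) i) y
        have hgm : Measurable fun w =>
            ENNReal.ofReal (Real.exp (-(l * |partialCost (setsWithMax (k + 1) i) w y|))) :=
          hg.comp hm
        rw [lintegral_const_mul _ hgm]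
        refine mul_le_mul_right ?_ _
        rw [← lintegral_map (f := fun r : ℝ => ENNReal.ofReal (Real.exp (-(l * |r|)))) hg hm,
          map_partialCost_kSpinLaw, card_setsWithMax]
        simpa using lintegral_exp_neg_mul_abs_gaussianReal_le ((i : ℕ).choose k : ℝ≥0) hl

theorem lintegral_exp_optValue_le {n k : ℕ} {l : ℝ} (hl : 0 ≤ l) (t : ℕ) (ht : t ≤ n) :
    ∫⁻ J, ENNReal.ofReal (Real.exp (l * optValue (partialCost (setsBelow n (k + 1) t) J)))
        ∂(kSpinLaw n (k + 1)) ≤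
      ENNReal.ofReal (Real.exp (∑ s ∈ Finset.range t, (-(Real.sqrt 2 / Real.sqrt Real.pi *
        (l * Real.sqrt (s.choose k))) + l ^ 2 * (s.choose k) / 2))) := by
  induction t with
  | zero =>
    have h : setsBelow n (k + 1) 0 = ∅ := by
      rw [← Finset.card_eq_zero, card_setsBelow ht, Nat.choose_zero_succ]
    have h2 : ∀ J : Couplings n (k + 1), optValue (partialCost ∅ J) = 0 := by
      intro J
      obtain ⟨z, hz⟩ := exists_eq_optValue (partialCost ∅ J)
      rw [← hz]
      simp [partialCost]
    simp [h, h2]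
  | succ t ih =>
    refine (lintegral_exp_optValue_succ_le ⟨t, ht⟩ hl).trans ?_
    rw [Finset.sum_range_succ, Real.exp_add (Finset.sum _ _), ENNReal.ofReal_mul (Real.exp_pos _).le]
    exact mul_le_mul_left (ih (Nat.le_of_succ_le ht)) _

/-! ### Normalisation and variance estimates -/

theorem kSpinCost_eq {n k : ℕ} (J : Couplings n k) (z : Assignment n) :
    kSpinCost J z = Real.sqrt ((k.factorial : ℝ) / (n : ℝ) ^ (k - 1)) *
      partialCost (setsBelow n k n) J z := by
  have : setsBelow n k n = Finset.univ := by
    simp [setsBelow, Finset.filter_true_of_mem]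
  rw [partialCost, this]
  rfl

theorem optValue_const_mul {n : ℕ} {c : ℝ} (hc : 0 ≤ c) (H : Assignment n → ℝ) :
    optValue (fun z => c * H z) = c * optValue H := by
  obtain ⟨z, hz⟩ := exists_eq_optValue H
  obtain ⟨w, hw⟩ := exists_eq_optValue fun z => c * H z
  refine le_antisymm ((optValue_le _ z).trans (by rw [hz])) ?_
  rw [← hw]
  exact mul_le_mul_of_nonneg_left (optValue_le H w) hc

/-- The normalisation `sqrt (k! / n^(k-1))` of the `k`-spin model, with `k + 1` in place of `k`. -/
def kSpinScale (n k : ℕ) : ℝ := Real.sqrt (((k + 1).factorial : ℝ) / (n : ℝ) ^ k)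

theorem kSpinScale_nonneg (n k : ℕ) : 0 ≤ kSpinScale n k := Real.sqrt_nonneg _

theorem kSpinScale_sq (n k : ℕ) :
    kSpinScale n k ^ 2 = ((k + 1).factorial : ℝ) / (n : ℝ) ^ k :=
  Real.sq_sqrt (by positivity)

theorem sum_range_choose (n k : ℕ) :
    ∑ s ∈ Finset.range n, s.choose k = n.choose (k + 1) := by
  induction n with
  | zero => simp
  | succ n ih => rw [Finset.sum_range_succ, ih, Nat.choose_succ_succ', add_comm]

theorem kSpinScale_sq_mul_choose (n k : ℕ) :
    kSpinScale n k ^ 2 * n.choose (k + 1) = (n.descFactorial (k + 1) : ℝ) / (n : ℝ) ^ k := by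
  rw [kSpinScale_sq, Nat.descFactorial_eq_factorial_mul_choose]
  push_cast
  ring

theorem variance_kSpin_le {n : ℕ} (hn : 1 ≤ n) (k : ℕ) :
    kSpinScale n k ^ 2 * n.choose (k + 1) ≤ n := by
  have hn' : (0 : ℝ) < n := by exact_mod_cast hn
  rw [kSpinScale_sq_mul_choose, div_le_iff₀ (by positivity), ← pow_succ']
  exact_mod_cast Nat.descFactorial_le_pow n (k + 1)

theorem one_le_of_two_mul_sq_le {n k : ℕ} (h : 2 * (k + 1) ^ 2 ≤ n) : 1 ≤ n :=
  (Nat.succ_le_of_lt (by positivity)).trans h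

/-- The falling factorial is at least $(n-k)^{k+1}$, and Bernoulli gives $(1-k/n)^{k+1}\ge
1-k(k+1)/n\ge 1/2$. -/
theorem half_le_variance_kSpin {n k : ℕ} (h : 2 * (k + 1) ^ 2 ≤ n) :
    (n : ℝ) / 2 ≤ kSpinScale n k ^ 2 * n.choose (k + 1) := by
  have hkn : k ≤ n := by nlinarith
  have hn : (0 : ℝ) < n := by
    have : 0 < n := by nlinarith
    exact_mod_cast this
  have h' : 2 * ((k : ℝ) + 1) ^ 2 ≤ n := by exact_mod_cast h
  have hk0 : (0 : ℝ) ≤ k := Nat.cast_nonneg k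
  rw [kSpinScale_sq_mul_choose, le_div_iff₀ (by positivity)]
  have h1 : (((n + 1 - (k + 1)) ^ (k + 1) : ℕ) : ℝ) ≤ n.descFactorial (k + 1) := by
    exact_mod_cast Nat.pow_sub_le_descFactorial n (k + 1)
  rw [Nat.add_sub_add_right] at h1
  push_cast [Nat.cast_sub hkn] at h1
  refine le_trans ?_ h1
  have hfrac : (k : ℝ) / n ≤ 1 := by
    rw [div_le_one hn]
    exact_mod_cast hkn
  have h2 := one_add_mul_le_pow (a := -((k : ℝ) / n)) (by linarith) (k + 1)
  have h3 : ((k + 1 : ℕ) : ℝ) * ((k : ℝ) / n) ≤ 1 / 2 := by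
    rw [mul_div_assoc', div_le_iff₀ hn]
    push_cast
    nlinarith
  have h4 : (1 : ℝ) / 2 ≤ (1 + -((k : ℝ) / n)) ^ (k + 1) := by linarith
  calc (n : ℝ) / 2 * n ^ k = n ^ (k + 1) * (1 / 2) := by ring
    _ ≤ n ^ (k + 1) * (1 + -((k : ℝ) / n)) ^ (k + 1) := by gcongr
    _ = ((n : ℝ) - k) ^ (k + 1) := by
      rw [← mul_pow]
      congr 1
      field_simp
      ring

theorem kSpinScale_sq_mul_choose_le {n s : ℕ} (hn : 1 ≤ n) (hs : s ≤ n) (k : ℕ) :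
    kSpinScale n k ^ 2 * s.choose k ≤ k + 1 := by
  have hn' : (0 : ℝ) < n := by exact_mod_cast hn
  have hs' : (s : ℝ) ≤ n := by exact_mod_cast hs
  have hf : (0 : ℝ) < k.factorial := by exact_mod_cast k.factorial_pos
  calc kSpinScale n k ^ 2 * s.choose k
      ≤ ((k + 1).factorial : ℝ) / (n : ℝ) ^ k * ((n : ℝ) ^ k / k.factorial) := by
        rw [kSpinScale_sq]
        gcongr
        refine (Nat.choose_le_pow_div k s).trans ?_
        gcongr
    _ = k + 1 := by
        rw [Nat.factorial_succ]
        push_cast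
        field_simp

/-- Each summand $\sigma$ has $\sigma^2\le k+1$, hence $\sigma\le k+1$ and
$\sigma\ge\sigma^2/(k+1)$; the $\sigma^2$ add up to the variance, which is at least $n/2$. -/
theorem le_sum_kSpinScale_mul_sqrt {n k : ℕ} (h : 2 * (k + 1) ^ 2 ≤ n) :
    (n : ℝ) / (2 * (k + 1)) ≤
      ∑ s ∈ Finset.range n, kSpinScale n k * Real.sqrt (s.choose k) := by
  have hn : 1 ≤ n := one_le_of_two_mul_sq_le h
  have hk0 : (0 : ℝ) < (k : ℝ) + 1 := by positivity
  rw [← div_div, div_le_iff₀ hk0, Finset.sum_mul]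
  refine (half_le_variance_kSpin h).trans ?_
  rw [← sum_range_choose, Nat.cast_sum, Finset.mul_sum]
  refine Finset.sum_le_sum fun s hs => ?_
  have h1 := kSpinScale_sq_mul_choose_le hn (Finset.mem_range.1 hs).le k
  have hx : 0 ≤ kSpinScale n k * Real.sqrt (s.choose k) :=
    mul_nonneg (kSpinScale_nonneg n k) (Real.sqrt_nonneg _)
  have h2 : kSpinScale n k ^ 2 * s.choose k = (kSpinScale n k * Real.sqrt (s.choose k)) ^ 2 := by
    rw [mul_pow, Real.sq_sqrt (Nat.cast_nonneg _)]
  rw [h2] at h1 ⊢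
  have h3 : kSpinScale n k * Real.sqrt (s.choose k) ≤ k + 1 := by
    refine abs_le_of_sq_le_sq' ?_ hk0.le |>.2
    nlinarith
  nlinarith

/-! ### Tail bounds for the $k$-spin model -/

theorem kSpinCost_eq_scale_mul {n k : ℕ} (J : Couplings n (k + 1)) :
    kSpinCost J = fun z => kSpinScale n k * partialCost (setsBelow n (k + 1) n) J z :=
  funext fun z => kSpinCost_eq J z

theorem measurable_kSpinCost {n k : ℕ} (z : Assignment n) :
    Measurable fun J : Couplings n k => kSpinCost J z := by
  unfold kSpinCost
  fun_prop

/-- The Gaussian tail bound for the energy of a fixed assignment. -/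
theorem kSpinLaw_kSpinCost_le {n k : ℕ} (h : 2 * (k + 1) ^ 2 ≤ n) (z : Assignment n) {s : ℝ}
    (hs : 0 ≤ s) :
    (kSpinLaw n (k + 1)).real {J | kSpinCost J z ≤ -s} ≤ Real.exp (-(s ^ 2 / (2 * n))) := by
  have hn : 1 ≤ n := one_le_of_two_mul_sq_le h
  have hn' : (0 : ℝ) < n := by exact_mod_cast hn
  have hV := half_le_variance_kSpin h
  have hV2 := variance_kSpin_le hn k
  have hVpos : 0 < kSpinScale n k ^ 2 * n.choose (k + 1) := by linarith
  have hch : n.choose (k + 1) ≠ 0 := by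
    intro h0
    simp [h0] at hVpos
  have hc : 0 < kSpinScale n k := by
    refine lt_of_le_of_ne (kSpinScale_nonneg n k) fun h0 => ?_
    simp [← h0] at hVpos
  have hset : {J : Couplings n (k + 1) | kSpinCost J z ≤ -s} =
      (fun J => partialCost (setsBelow n (k + 1) n) J z) ⁻¹' Set.Iic (-(s / kSpinScale n k)) := by
    ext J
    simp only [kSpinCost_eq_scale_mul, Set.mem_ofPred_eq, Set.mem_preimage, Set.mem_Iic]
    rw [← neg_div, le_div_iff₀' hc]
  rw [hset, ← map_measureReal_apply (measurable_partialCost _ z) measurableSet_Iic,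
    map_partialCost_kSpinLaw, card_setsBelow le_rfl]
  refine (gaussianReal_real_Iic_neg_le (by exact_mod_cast hch) (by positivity)).trans ?_
  rw [Real.exp_le_exp, neg_le_neg_iff, div_pow, div_div]
  push_cast
  gcongr s ^ 2 / ?_
  linarith

/-- Markov's inequality for $e^{lE^*}$. The quadratic terms add up to $l^2/2$ times the variance of
$H(z)$, which is at most $n$. -/
theorem measure_lt_optValue_kSpinCost_le {n k : ℕ} (hn : 1 ≤ n) {l : ℝ} (hl : 0 ≤ l) (t : ℝ) :
    (kSpinLaw n (k + 1)).real {J | -t < optValue (kSpinCost J)} ≤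
      Real.exp (l * t - Real.sqrt 2 / Real.sqrt Real.pi *
        (l * ∑ s ∈ Finset.range n, kSpinScale n k * Real.sqrt (s.choose k)) + l ^ 2 * n / 2) := by
  have hmeas : Measurable fun J : Couplings n (k + 1) =>
      ENNReal.ofReal (Real.exp (l * optValue (kSpinCost J))) :=
    (((measurable_optValue measurable_kSpinCost).const_mul l).exp).ennreal_ofReal
  have h1 := mul_meas_ge_le_lintegral (μ := kSpinLaw n (k + 1)) hmeas
    (ENNReal.ofReal (Real.exp (-(l * t))))
  have h2 := lintegral_exp_optValue_le (n := n) (k := k)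
    (mul_nonneg hl (kSpinScale_nonneg n k)) n le_rfl
  have h3 : ∀ J : Couplings n (k + 1), l * optValue (kSpinCost J) =
      l * kSpinScale n k * optValue (partialCost (setsBelow n (k + 1) n) J) := by
    intro J
    rw [kSpinCost_eq_scale_mul, optValue_const_mul (kSpinScale_nonneg n k), mul_assoc]
  simp_rw [h3] at h1
  have h4 := h1.trans h2
  have h5 : (kSpinLaw n (k + 1)) {J | -t < optValue (kSpinCost J)} ≤
      (kSpinLaw n (k + 1)) {J | ENNReal.ofReal (Real.exp (-(l * t))) ≤ ENNReal.ofReal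
        (Real.exp (l * kSpinScale n k * optValue (partialCost (setsBelow n (k + 1) n) J)))} := by
    refine measure_mono fun J hJ => ?_
    rw [Set.mem_ofPred_eq] at hJ ⊢
    refine ENNReal.ofReal_le_ofReal (Real.exp_le_exp.2 ?_)
    rw [← h3, ← mul_neg]
    exact mul_le_mul_of_nonneg_left hJ.le hl
  have h6 := (mul_le_mul_right h5 (ENNReal.ofReal (Real.exp (-(l * t))))).trans h4
  have h7 := ENNReal.toReal_mono ENNReal.ofReal_ne_top h6
  rw [ENNReal.toReal_mul, ENNReal.toReal_ofReal (Real.exp_pos _).le,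
    ENNReal.toReal_ofReal (Real.exp_pos _).le, Real.exp_neg, inv_mul_le_iff₀ (Real.exp_pos _),
    ← Real.exp_add] at h7
  refine h7.trans (Real.exp_le_exp.2 ?_)
  rw [Finset.sum_add_distrib, Finset.sum_neg_distrib, ← Finset.mul_sum, ← Finset.sum_div,
    ← Finset.mul_sum, ← Finset.mul_sum, ← Nat.cast_sum, sum_range_choose]
  rw [← Finset.mul_sum, mul_assoc l, mul_pow, mul_assoc (l ^ 2)]
  have := mul_le_mul_of_nonneg_left (variance_kSpin_le hn k) (sq_nonneg l)
  linarith

/-- The optimal value of the `k`-spin model is of order `n / k`, up to exponentially small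
probability. -/
theorem measure_lt_optValue_kSpinCost_le_exp {n k : ℕ} (h : 2 * (k + 1) ^ 2 ≤ n) :
    (kSpinLaw n (k + 1)).real
        {J | -(Real.sqrt 2 / (4 * (k + 1) * Real.sqrt Real.pi) * n) < optValue (kSpinCost J)} ≤
      Real.exp (-(n / (32 * Real.pi * (k + 1) ^ 2))) := by
  have hn : 1 ≤ n := one_le_of_two_mul_sq_le h
  have hn' : (0 : ℝ) < n := by exact_mod_cast hn
  have hk0 : (0 : ℝ) < (k : ℝ) + 1 := by positivity
  have hp := Real.sqrt_pos.2 Real.pi_pos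
  -- With this `l` the level is $-\sqrt2\,ln$, and the exponent is at most
  -- $(\sqrt2-2\sqrt2+\tfrac12)l^2n\le-l^2n/2$.
  set l : ℝ := 1 / (4 * (k + 1) * Real.sqrt Real.pi) with hl
  have hl0 : 0 < l := by positivity
  refine (measure_lt_optValue_kSpinCost_le hn hl0.le _).trans (Real.exp_le_exp.2 ?_)
  have hS := le_sum_kSpinScale_mul_sqrt h
  set S := ∑ s ∈ Finset.range n, kSpinScale n k * Real.sqrt (s.choose k)
  have h2 : (1 : ℝ) ≤ Real.sqrt 2 := Real.one_le_sqrt.2 one_le_two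
  have h1 : Real.sqrt 2 / Real.sqrt Real.pi * (l * ((n : ℝ) / (2 * (k + 1)))) ≤
      Real.sqrt 2 / Real.sqrt Real.pi * (l * S) := by gcongr
  have h3 : Real.sqrt 2 / Real.sqrt Real.pi * (l * ((n : ℝ) / (2 * (k + 1)))) =
      2 * Real.sqrt 2 * (l ^ 2 * n) := by
    rw [hl]
    field_simp
    norm_num
  have h4 : l * (Real.sqrt 2 / (4 * (k + 1) * Real.sqrt Real.pi) * n) =
      Real.sqrt 2 * (l ^ 2 * n) := by
    rw [hl]
    field_simp
  have h5 : (n : ℝ) / (32 * Real.pi * (k + 1) ^ 2) = l ^ 2 * n / 2 := by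
    rw [hl, div_pow, mul_pow, mul_pow, Real.sq_sqrt Real.pi_pos.le]
    field_simp
    norm_num
  rw [h4, h5]
  have h6 : 0 ≤ l ^ 2 * n := by positivity
  nlinarith

/-! ### Combining the two bad events -/

theorem two_mul_sq_le_of_one_lt_kSpinGamma_mul {n k : ℕ} {η : ℝ} (hη₀ : 0 ≤ η) (hη₁ : η ≤ 1)
    (h : 1 < kSpinGamma (k + 1) η * n) : 2 * (k + 1) ^ 2 ≤ n := by
  have hk0 : (0 : ℝ) < (k : ℝ) + 1 := by positivity
  have hlog : (0.5 : ℝ) < Real.log 2 := by linarith [Real.log_two_gt_d9]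
  have hpi := Real.pi_gt_three
  have hD : 0 < 32 * Real.pi * Real.log 2 * ((k : ℝ) + 1) ^ 2 := by positivity
  rw [kSpinGamma, div_mul_eq_mul_div, Nat.cast_add, Nat.cast_one, lt_div_iff₀ hD, one_mul] at h
  have h1 : (1 - η) ^ 2 * n ≤ 1 * (n : ℝ) := by
    gcongr
    nlinarith
  have h2 : 2 * ((k : ℝ) + 1) ^ 2 ≤ 32 * Real.pi * Real.log 2 * ((k : ℝ) + 1) ^ 2 := by
    gcongr
    nlinarith
  have h3 : 2 * ((k : ℝ) + 1) ^ 2 ≤ n := by linarith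
  exact_mod_cast h3

theorem countBelow_mono {n : ℕ} (H : Assignment n → ℝ) {E F : ℝ} (h : E ≤ F) :
    countBelow H E ≤ countBelow H F :=
  Finset.card_le_card fun z hz => by
    rw [Finset.mem_filter] at hz ⊢
    exact ⟨hz.1, hz.2.trans h⟩

theorem kSpin_countBelow_le {n k : ℕ} {η : ℝ} (hη₀ : 0 ≤ η) (hη₁ : η ≤ 1) :
    1 - (2 : ℝ) ^ (-(kSpinGamma (k + 1) η) * (n : ℝ) + 1) ≤
      (kSpinLaw n (k + 1)).real
        {J | (countBelow (kSpinCost J) ((1 - η) * optValue (kSpinCost J)) : ℝ) ≤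
          (2 : ℝ) ^ ((1 - kSpinGamma (k + 1) η) * (n : ℝ))} := by
  set g := kSpinGamma (k + 1) η with hg
  -- If $\gamma n\le1$ the claimed probability $1-2^{1-\gamma n}$ is not positive; otherwise $n\ge
  -- 2(k+1)^2$, as the variance bounds require.
  rcases le_or_gt (g * n) 1 with hsmall | hlarge
  · have h1 : (1 : ℝ) ≤ (2 : ℝ) ^ (-g * (n : ℝ) + 1) :=
      Real.one_le_rpow one_le_two (by linarith)
    exact le_trans (by linarith) measureReal_nonneg
  have hkn := two_mul_sq_le_of_one_lt_kSpinGamma_mul hη₀ hη₁ hlarge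
  have hn : 1 ≤ n := one_le_of_two_mul_sq_le hkn
  have hn' : (0 : ℝ) < n := by exact_mod_cast hn
  have hk0 : (0 : ℝ) < (k : ℝ) + 1 := by positivity
  have hp := Real.sqrt_pos.2 Real.pi_pos
  have hlog : 0 < Real.log 2 := Real.log_pos one_lt_two
  set μ := kSpinLaw n (k + 1)
  set t : ℝ := Real.sqrt 2 / (4 * (k + 1) * Real.sqrt Real.pi) * n with ht
  have ht0 : 0 ≤ t := by positivity
  set a : ℝ := (2 : ℝ) ^ ((1 - g) * (n : ℝ)) with ha
  have ha0 : 0 < a := Real.rpow_pos_of_pos two_pos _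
  set q : ℝ := Real.exp (-(g * n * Real.log 2)) with hq
  have hrhs : (2 : ℝ) ^ (-g * (n : ℝ) + 1) = 2 * q := by
    rw [Real.rpow_add_one two_ne_zero, Real.rpow_def_of_pos two_pos, hq]
    ring_nf
  have hglog : g * n * Real.log 2 = (1 - η) ^ 2 * (n / (32 * Real.pi * (k + 1) ^ 2)) := by
    rw [hg, kSpinGamma]
    push_cast
    field_simp
  have hA : μ.real {J | -t < optValue (kSpinCost J)} ≤ q := by
    refine (measure_lt_optValue_kSpinCost_le_exp hkn).trans (Real.exp_le_exp.2 ?_)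
    rw [hglog, neg_le_neg_iff]
    refine mul_le_of_le_one_left (by positivity) ?_
    nlinarith
  have hB : μ.real {J | a ≤ (countBelow (kSpinCost J) (-((1 - η) * t)) : ℝ)} ≤ q := by
    have hs : 0 ≤ (1 - η) * t := mul_nonneg (by linarith) ht0
    refine (measure_le_card_filter_le μ (fun z J => kSpinCost J z ≤ -((1 - η) * t))
      (fun z => measurableSet_le (measurable_kSpinCost z) measurable_const)
      (fun z => kSpinLaw_kSpinCost_le hkn z hs) ha0).trans (le_of_eq ?_)
    -- Each assignment is below the level with probability at most $2^{-2\gamma n}$: one factor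
    -- $2^{-\gamma n}$ matches the allowed count in Markov's inequality, the other is the failure
    -- probability.
    have hexp : ((1 - η) * t) ^ 2 / (2 * n) = g * n * Real.log 2 + g * n * Real.log 2 := by
      rw [hglog, ht, mul_pow, mul_pow, div_pow, mul_pow, mul_pow, Real.sq_sqrt Real.pi_pos.le,
        Real.sq_sqrt two_pos.le]
      field_simp
      ring
    rw [div_eq_iff ha0.ne', hexp, neg_add, Real.exp_add, ha, two_rpow_one_sub_mul]
    simp only [Fintype.card_fun, Fintype.card_fin, Fintype.card_units_int]
    push_cast
    ring
  have hcover : (Set.univ : Set (Couplings n (k + 1))) ⊆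
      {J | (countBelow (kSpinCost J) ((1 - η) * optValue (kSpinCost J)) : ℝ) ≤ a} ∪
      ({J | -t < optValue (kSpinCost J)} ∪
        {J | a ≤ (countBelow (kSpinCost J) (-((1 - η) * t)) : ℝ)}) := by
    intro J _
    by_cases h1 : -t < optValue (kSpinCost J)
    · exact Or.inr (Or.inl h1)
    by_cases h2 : a ≤ (countBelow (kSpinCost J) (-((1 - η) * t)) : ℝ)
    · exact Or.inr (Or.inr h2)
    refine Or.inl (le_trans ?_ (not_le.1 h2).le)
    have h3 : (1 - η) * optValue (kSpinCost J) ≤ -((1 - η) * t) := by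
      rw [← mul_neg]
      exact mul_le_mul_of_nonneg_left (not_lt.1 h1) (by linarith)
    exact_mod_cast countBelow_mono _ h3
  have hμ := (measureReal_mono (μ := μ) hcover).trans
    ((measureReal_union_le _ _).trans (add_le_add_right (measureReal_union_le _ _) _))
  rw [probReal_univ] at hμ
  rw [hrhs]
  linarith

end TailBound

end

theorem mainTheorem9 (n k : ℕ) (hn : 1 ≤ n) (hk : 1 ≤ k) (η : ℝ) (hη₀ : 0 ≤ η) (hη₁ : η ≤ 1) :
    (∀ (m : ℕ), 1 ≤ m → ∀ c : Fin m → TailBound.Constraint n k,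
      (∀ i : Fin n, (TailBound.cspDegree c i : ℝ) ≤ 2 * (k : ℝ) * (m : ℝ) / (n : ℝ)) →
      (TailBound.countBelow (TailBound.cspCost c)
          ((1 - η) * TailBound.optValue (TailBound.cspCost c)) : ℝ) ≤
        (2 : ℝ) ^ ((1 - TailBound.cspGamma k m (TailBound.optValue (TailBound.cspCost c)) η) *
          (n : ℝ))) ∧
    (1 - (2 : ℝ) ^ (-(TailBound.kSpinGamma k η) * (n : ℝ) + 1) ≤
      (TailBound.kSpinLaw n k).real
        {J | (TailBound.countBelow (TailBound.kSpinCost J)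
            ((1 - η) * TailBound.optValue (TailBound.kSpinCost J)) : ℝ) ≤
          (2 : ℝ) ^ ((1 - TailBound.kSpinGamma k η) * (n : ℝ))}) := by
  refine ⟨fun m hm c hc => TailBound.countBelow_cspCost_le hn hk hm hη₁ c hc, ?_⟩
  -- Shifting `k` by one removes the truncated subtraction in the exponent `k - 1`.
  obtain ⟨k, rfl⟩ := Nat.exists_eq_add_of_le' hk
  exact TailBound.kSpin_countBelow_le hη₀ hη₁
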